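/- Let $\mathcal L\in\{\mathcal{EL},\mathcal{ELI},\mathcal{EL}_\bot,\mathcal{ELI}_\bot\}$. An instance is a set of facts $A(a)$, $R(a,b)$ over unary symbols (concept names) and binary symbols (role names); its domain is the set $\mathrm{adom}(I)$ of values occurring in its facts, and $\mathcal L$-concepts are interpreted in it as usual ($\top^I=\mathrm{adom}(I)$, $\bot^I=\emptyset$). An $\mathcal L$-TGD is a concept inclusion $C\sqsubseteq D$ between $\mathcal L$-concepts, satisfied by $I$ if $C^I\subseteq D^I$; an $\mathcal L$-ontology is a finite set of $\mathcal L$-TGDs, and $I$ satisfies it if it satisfies all its elements. A fitting instance is a pair $(\mathsf P,\mathsf N)$ of finite non-empty sets of finite instances; an $\mathcal L$-TGD or $\mathcal L$-ontology over the symbols used in $\mathsf P\cup\mathsf N$ fits it if it is satisfied by every $I\in\mathsf P$ and by no $J\in\mathsf N$. A finite $\mathcal L$-basis, relative to a finite schema $\mathcal S$, of a finite $\mathcal S$-instance $I$ is an $\mathcal L$-ontology $\mathcal O$ over $\mathcal S$ such that, for all $\mathcal L$-TGDs $\rho$ over $\mathcal S$, $\mathcal O\models\rho$ (every finite or infinite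 instance satisfying $\mathcal O$ satisfies $\rho$) if and only if $I\models\rho$. The size of an object is the length of its encoding as a word over a finite alphabet; a succinct representation of an ontology (or of a TGD, seen as an ontology with one element) uses structure sharing: subconcepts are nodes, and pointers to nodes may be shared by different occurrences of the same subconcept. 1. (Fittings.) There is a polynomial $p$ such that for every $n\ge 1$ there is a fitting instance $(\mathsf P_n,\mathsf N_n)$ such that (a) the size of $(\mathsf P_n,\mathsf N_n)$ is at most $p(n)$; (b) $(\mathsf P_n,\mathsf N_n)$ admits a fitting $\mathcal L$-TGD and a fitting $\mathcal L$-ontology; (c) every $\mathcal L$-TGD that fits $(\mathsf P_n,\mathsf N_n)$ has size at least $2^{2^n}$, and size at least $2^n$ when represented succinctly; and the same holds for every $\mathcal L$-ontology that fits $(\mathsf P_n,\mathsf N_n)$. 2. (Finite bases.) There is a polynomial $p$ such that for every $n\ge 1$ there is a finite instance $I_n$ of size at most $p(n)$ such that, relative to every finite schema $\mathcal S$ that contains the symbols used in $I_n$, $I_n$ has a finite $\mathcal L$-basis, and every finite $\mathcal L$-basis of $I_n$ has size at least $2^{2^n}$, and size at least $2^n$ when represented succinctly. -/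

import Mathlib

/-!
Description logics EL, ELI, EL_bot, ELI_bot over instances with unary and binary relation
symbols, fitting instances, finite bases, and the (plain and succinct) size of these objects.
Concept names, role names and the values of finite instances are natural numbers.
-/

namespace DLFit

/-! ### Instances -/

/-- A fact `A(a)` (for a concept name `A`) or `R(a, b)` (for a role name `R`). -/
inductive Fact (V : Type) : Type
  | unary (A : ℕ) (a : V)
  | binary (R : ℕ) (a b : V)
  deriving DecidableEq

/-- A possibly infinite instance with values in `V`. -/
abbrev Inst (V : Type) : Type := Set (Fact V)

/-- A finite instance. -/
abbrev FinInst : Type := Finset (Fact ℕ)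

/-- The values that occur in a fact. -/
def Fact.values {V : Type} : Fact V → Set V
  | .unary _ a => {a}
  | .binary _ a b => {a, b}

/-- The active domain. -/
def adom {V : Type} (I : Inst V) : Set V := {d | ∃ φ ∈ I, d ∈ φ.values}

/-- A schema that contains only unary and binary relation symbols. -/
structure Schema : Type where
  conceptNames : Finset ℕ
  roleNames : Finset ℕ

/-- The relation symbol of a fact belongs to the schema. -/
def Fact.IsOver {V : Type} (S : Schema) : Fact V → Prop
  | .unary A _ => A ∈ S.conceptNames
  | .binary R _ _ => R ∈ S.roleNames

/-- `I` is an `S`-instance. -/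
def Inst.IsOver {V : Type} (S : Schema) (I : Inst V) : Prop := ∀ φ ∈ I, φ.IsOver S

/-! ### Concepts -/

/-- A role name or an inverse role. -/
inductive Role : Type
  | fwd (R : ℕ)
  | inv (R : ℕ)
  deriving DecidableEq

/-- The underlying role name. -/
def Role.symb : Role → ℕ
  | .fwd R => R
  | .inv R => R

/-- `r.rel I d e` says that `(d, e)` is in the extension of the role `r` in `I`. -/
def Role.rel {V : Type} (I : Inst V) : Role → V → V → Prop
  | .fwd R, d, e => Fact.binary R d e ∈ I
  | .inv R, d, e => Fact.binary R e d ∈ I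

/-- ELI_bot-concepts. -/
inductive Concept : Type
  | top
  | bot
  | name (A : ℕ)
  | conj (C D : Concept)
  | ex (r : Role) (C : Concept)
  deriving DecidableEq

/-- The extension of a concept in an instance; the domain is the active domain, so that every
concept has an empty extension in the empty instance. -/
def Concept.ext {V : Type} (I : Inst V) : Concept → Set V
  | .top => adom I
  | .bot => ∅
  | .name A => {d | Fact.unary A d ∈ I}
  | .conj C D => C.ext I ∩ D.ext I
  | .ex r C => {d | ∃ e, r.rel I d e ∧ e ∈ C.ext I}

/-- All symbols of the concept belong to the schema. -/
def Concept.IsOver (S : Schema) : Concept → Prop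
  | .top => True
  | .bot => True
  | .name A => A ∈ S.conceptNames
  | .conj C D => C.IsOver S ∧ D.IsOver S
  | .ex r C => r.symb ∈ S.roleNames ∧ C.IsOver S

/-- The four description logics. -/
inductive DL : Type
  | EL
  | ELI
  | ELbot
  | ELIbot

/-- The description logics that have the concept `⊥`. -/
def DL.HasBot : DL → Prop
  | .EL => False
  | .ELI => False
  | .ELbot => True
  | .ELIbot => True

/-- The description logics that have inverse roles. -/
def DL.HasInverse : DL → Prop
  | .EL => False
  | .ELI => True
  | .ELbot => False
  | .ELIbot => True

/-- The roles that may be used in concepts of the logic `L`. -/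
def Role.IsIn (L : DL) : Role → Prop
  | .fwd _ => True
  | .inv _ => L.HasInverse

/-- `C` is an `L`-concept. -/
def Concept.IsIn (L : DL) : Concept → Prop
  | .top => True
  | .bot => L.HasBot
  | .name _ => True
  | .conj C D => C.IsIn L ∧ D.IsIn L
  | .ex r C => r.IsIn L ∧ C.IsIn L

/-! ### Concept inclusions (TGDs) and ontologies -/

/-- A concept inclusion `lhs ⊑ rhs`, also called a TGD. -/
@[ext]
structure TGD : Type where
  lhs : Concept
  rhs : Concept
  deriving DecidableEq

/-- An ontology is a finite set of concept inclusions. -/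
abbrev Ontology : Type := Finset TGD

/-- `ρ` is an `L`-TGD over the schema `S`. -/
def TGD.IsTGD (L : DL) (S : Schema) (ρ : TGD) : Prop :=
  (ρ.lhs.IsIn L ∧ ρ.rhs.IsIn L) ∧ (ρ.lhs.IsOver S ∧ ρ.rhs.IsOver S)

/-- `O` is an `L`-ontology over the schema `S`. -/
def IsOntology (L : DL) (S : Schema) (O : Ontology) : Prop := ∀ ρ ∈ O, ρ.IsTGD L S

/-- The instance `I` satisfies the concept inclusion `ρ`. -/
def Sat {V : Type} (I : Inst V) (ρ : TGD) : Prop := ρ.lhs.ext I ⊆ ρ.rhs.ext I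

/-- The instance `I` is a model of the ontology `O`. -/
def IsModel {V : Type} (I : Inst V) (O : Ontology) : Prop := ∀ ρ ∈ O, Sat I ρ

/-- Every (finite or infinite) model of `O` satisfies `ρ`. -/
def Entails (O : Ontology) (ρ : TGD) : Prop :=
  ∀ (V : Type) (I : Inst V), IsModel I O → Sat I ρ

/-! ### Fitting -/

/-- A fitting instance: finite non-empty sets of finite instances, the positive and the negative
examples. -/
structure FittingInstance : Type where
  pos : Finset FinInst
  neg : Finset FinInst
  pos_nonempty : pos.Nonempty
  neg_nonempty : neg.Nonempty

/-- The concept name of a fact, if it is unary. -/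
def Fact.conceptNames {V : Type} : Fact V → Finset ℕ
  | .unary A _ => {A}
  | .binary _ _ _ => ∅

/-- The role name of a fact, if it is binary. -/
def Fact.roleNames {V : Type} : Fact V → Finset ℕ
  | .unary _ _ => ∅
  | .binary R _ _ => {R}

/-- The set of the symbols that are used in the examples. -/
def FittingInstance.schema (E : FittingInstance) : Schema where
  conceptNames := (E.pos ∪ E.neg).biUnion fun I => I.biUnion Fact.conceptNames
  roleNames := (E.pos ∪ E.neg).biUnion fun I => I.biUnion Fact.roleNames

/-- The TGD `ρ` is an `L`-TGD that fits `E`. -/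
def FitsTGD (L : DL) (E : FittingInstance) (ρ : TGD) : Prop :=
  ρ.IsTGD L E.schema ∧
    (∀ I ∈ E.pos, Sat (I : Inst ℕ) ρ) ∧ (∀ J ∈ E.neg, ¬ Sat (J : Inst ℕ) ρ)

/-- The ontology `O` is an `L`-ontology that fits `E`. -/
def FitsOntology (L : DL) (E : FittingInstance) (O : Ontology) : Prop :=
  IsOntology L E.schema O ∧
    (∀ I ∈ E.pos, IsModel (I : Inst ℕ) O) ∧ (∀ J ∈ E.neg, ¬ IsModel (J : Inst ℕ) O)

/-! ### Finite bases -/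

/-- The ontology `O` over `S` is a finite `L`-basis of the finite `S`-instance `I`: the `L`-TGDs
over `S` that `O` entails are exactly those that `I` satisfies. -/
def IsFiniteBasis (L : DL) (S : Schema) (I : FinInst) (O : Ontology) : Prop :=
  IsOntology L S O ∧
    ∀ ρ : TGD, ρ.IsTGD L S → (Entails O ρ ↔ Sat (I : Inst ℕ) ρ)

/-! ### Size: length of an encoding as a word over a finite alphabet -/

/-- The finite alphabet of the encodings. -/
inductive Letter : Type
  | bit (b : Bool)
  | endNum
  | top
  | bot
  | name
  | conj
  | ex
  | exInv
  | subsumed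
  | unary
  | binary
  | endInst

/-- The binary encoding of a natural number (a name, a value or a pointer), with an end marker. -/
def numWord (k : ℕ) : List Letter := k.bits.map Letter.bit ++ [Letter.endNum]

/-- The word for the existential restriction to a role. -/
def Role.word : Role → List Letter
  | .fwd R => Letter.ex :: numWord R
  | .inv R => Letter.exInv :: numWord R

/-- The encoding of a concept, in prefix notation. -/
def Concept.word : Concept → List Letter
  | .top => [Letter.top]
  | .bot => [Letter.bot]
  | .name A => Letter.name :: numWord A
  | .conj C D => Letter.conj :: (C.word ++ D.word)
  | .ex r C => r.word ++ C.word

/-- The encoding of a concept inclusion. -/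
def TGD.word (ρ : TGD) : List Letter := Letter.subsumed :: (ρ.lhs.word ++ ρ.rhs.word)

/-- The size of a TGD. -/
def TGD.size (ρ : TGD) : ℕ := ρ.word.length

/-- The size of an ontology: the length of the concatenation, in any order, of the encodings of
its elements. -/
def ontologySize (O : Ontology) : ℕ := ∑ ρ ∈ O, ρ.size

/-- The encoding of a fact. -/
def Fact.word : Fact ℕ → List Letter
  | .unary A a => Letter.unary :: (numWord A ++ numWord a)
  | .binary R a b => Letter.binary :: (numWord R ++ numWord a ++ numWord b)

/-- The size of a finite instance: the length of the concatenation, in any order, of the encodings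
of its facts, followed by an end marker. -/
def instSize (I : FinInst) : ℕ := (∑ φ ∈ I, φ.word.length) + [Letter.endInst].length

/-- The size of a fitting instance: the positive examples, an end marker, the negative examples. -/
def FittingInstance.size (E : FittingInstance) : ℕ :=
  (∑ I ∈ E.pos, instSize I) + [Letter.endInst].length + (∑ J ∈ E.neg, instSize J)

/-! ### Succinct representation -/

/-- A node of a succinct representation: a concept whose immediate subconcepts are replaced by
pointers, i.e. by positions in a list of nodes. -/
inductive Node : Type
  | top
  | bot
  | name (A : ℕ)
  | conj (i j : ℕ)
  | ex (r : Role) (i : ℕ)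

/-- The node at position `i` of the list `g` represents the concept `C`. Positions from which
the pointers lead into a cycle or out of the list represent nothing. -/
inductive Denotes (g : List Node) : ℕ → Concept → Prop
  | top {i : ℕ} (h : g[i]? = some Node.top) : Denotes g i Concept.top
  | bot {i : ℕ} (h : g[i]? = some Node.bot) : Denotes g i Concept.bot
  | name {i A : ℕ} (h : g[i]? = some (Node.name A)) : Denotes g i (Concept.name A)
  | conj {i j k : ℕ} {C D : Concept} (h : g[i]? = some (Node.conj j k))
      (hC : Denotes g j C) (hD : Denotes g k D) : Denotes g i (Concept.conj C D)
  | ex {i j : ℕ} {r : Role} {C : Concept} (h : g[i]? = some (Node.ex r j))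
      (hC : Denotes g j C) : Denotes g i (Concept.ex r C)

/-- Data of a succinct representation of an ontology: nodes for the subconcepts, and the
inclusions as pairs of pointers. -/
structure SuccinctRep : Type where
  nodes : List Node
  inclusions : List (ℕ × ℕ)

/-- `G` represents the ontology `O` with structure sharing. A subconcept may be shared by all of
its occurrences; the representations in which each subconcept has exactly one node are among the
ones described here, and `G` represents a single TGD `ρ` if it represents `{ρ}`. -/
def SuccinctRep.Represents (G : SuccinctRep) (O : Ontology) : Prop :=
  (∀ p ∈ G.inclusions, ∃ ρ ∈ O, Denotes G.nodes p.1 ρ.lhs ∧ Denotes G.nodes p.2 ρ.rhs) ∧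
    (∀ ρ ∈ O, ∃ p ∈ G.inclusions, Denotes G.nodes p.1 ρ.lhs ∧ Denotes G.nodes p.2 ρ.rhs)

/-- The encoding of a node. -/
def Node.word : Node → List Letter
  | .top => [Letter.top]
  | .bot => [Letter.bot]
  | .name A => Letter.name :: numWord A
  | .conj i j => Letter.conj :: (numWord i ++ numWord j)
  | .ex r i => r.word ++ numWord i

/-- The encoding of a succinct representation. -/
def SuccinctRep.word (G : SuccinctRep) : List Letter :=
  G.nodes.flatMap Node.word ++
    G.inclusions.flatMap (fun p => Letter.subsumed :: (numWord p.1 ++ numWord p.2))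

/-- The size of a succinct representation. -/
def SuccinctRep.size (G : SuccinctRep) : ℕ := G.word.length

/-- The size of `O` in succinct form: the length of a shortest succinct representation of `O`. -/
noncomputable def succinctSize (O : Ontology) : ℕ :=
  sInf {k | ∃ G : SuccinctRep, G.Represents O ∧ G.size = k}

end DLFit

open DLFit

/-!
The same two instances serve both parts and all four logics: a positive example `cycles m` and a
negative example `star`.

Both contain a universal point `0`, which satisfies every concept that is satisfied anywhere, and
two guards `1` and `2`. For each of the two roles, one guard has exactly the two guards as
successors and the other one has exactly the universal point. Hence a satisfiable concept that
fails at both guards has either a concept name as a conjunct, or conjuncts `∃ 0. E₀` and `∃ 1. E₁`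
in which `E₀` and `E₁` fail at both guards again: failing at the guards forces binary branching. In
`cycles m` there are moreover directed cycles of the lengths `1, …, m`, and the concept name `0`
holds at position `0` of each cycle. If a concept fails at both guards and holds at position `j` of
all cycles, then its binary branching can only stop when the concept name `0` is reached in all
cycles at the same time, that is, after `h` steps where `j + h` is a common multiple of `1, …, m`
(`branching_of_forall_mem`). Since `centralBinom M` divides every common multiple of `1, …, 2 * M`,
`h` is exponential, so the concept is doubly exponential and its depth, a lower bound for succinct
representations, exponential.

In `star` the cycles are replaced by one point `3` that satisfies the concept name and has only the
guards as successors. The inclusion of the concept name `0` in a full binary tree of depth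
`m.factorial` holds in `cycles m` and fails in `star`. Conversely, suppose that an inclusion
`C ⊑ D` holds in `cycles m` but not in `star`. Homomorphisms between the two instances show that the
violation happens at `3`, and that `C`, hence also `D`, holds at position `0` of every cycle; as
`D` fails at `3`, it has a subconcept of the kind discussed above (`large_of_sat_of_not_sat`).

For the finite bases, every finite instance `I` has one: there are only finitely many extensions
`C^I`; pick a representative concept for each and take all valid inclusions between concepts that
are built with at most one constructor from representatives (`exists_isFiniteBasis`). Every basis
of `cycles m` has `cycles m` as a model and entails the tree inclusion, so `star` is no model of it
and the same lower bound applies.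
-/

open DLFit

namespace DLFit

/-! ### Extensions and homomorphisms -/

/-- Every fact of `I` is mapped by `f` to a fact of `J`. -/
def IsHom {V W : Type} (f : V → W) (I : Inst V) (J : Inst W) : Prop :=
  (∀ A a, Fact.unary A a ∈ I → Fact.unary A (f a) ∈ J) ∧
    ∀ R a b, Fact.binary R a b ∈ I → Fact.binary R (f a) (f b) ∈ J

theorem IsHom.mem_adom {V W : Type} {f : V → W} {I : Inst V} {J : Inst W} (hf : IsHom f I J)
    {d : V} (hd : d ∈ adom I) : f d ∈ adom J := by
  obtain ⟨φ, hφ, hd⟩ := hd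
  cases φ with
  | unary A a =>
    obtain rfl : d = a := hd
    exact ⟨_, hf.1 _ _ hφ, rfl⟩
  | binary R a b =>
    refine ⟨_, hf.2 _ _ _ hφ, ?_⟩
    rcases hd with rfl | rfl
    · exact Or.inl rfl
    · exact Or.inr rfl

theorem IsHom.mem_ext {V W : Type} {f : V → W} {I : Inst V} {J : Inst W} (hf : IsHom f I J)
    (C : Concept) : ∀ {d : V}, d ∈ C.ext I → f d ∈ C.ext J := by
  induction C with
  | top => exact hf.mem_adom
  | bot => exact fun h => h
  | name A => exact fun h => hf.1 _ _ h
  | conj C D hC hD => exact fun h => ⟨hC h.1, hD h.2⟩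
  | ex r C hC =>
    rintro d ⟨e, hr, he⟩
    refine ⟨f e, ?_, hC he⟩
    cases r with
    | fwd R => exact hf.2 _ _ _ hr
    | inv R => exact hf.2 _ _ _ hr

theorem Concept.ext_subset_adom {V : Type} (I : Inst V) (C : Concept) : C.ext I ⊆ adom I := by
  induction C with
  | top => exact subset_rfl
  | bot => exact Set.empty_subset _
  | name A => exact fun d hd => ⟨_, hd, rfl⟩
  | conj C D hC _ => exact fun d hd => hC hd.1
  | ex r C _ =>
    rintro d ⟨e, hr, -⟩
    cases r with
    | fwd R => exact ⟨_, hr, Or.inl rfl⟩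
    | inv R => exact ⟨_, hr, Or.inr rfl⟩

/-! ### Finite bases of finite instances -/

theorem finite_adom (I : FinInst) : (adom (I : Inst ℕ)).Finite := by
  have h : adom (I : Inst ℕ) = ⋃ φ ∈ I, Fact.values φ := by
    ext d
    simp [adom]
  rw [h]
  refine I.finite_toSet.biUnion fun φ _ => ?_
  cases φ <;> simp [Fact.values]

/-- Every finite instance has a finite basis, over every finite schema and in all four logics. -/
theorem exists_isFiniteBasis (L : DL) (S : Schema) (I : FinInst) :
    ∃ O : Ontology, IsFiniteBasis L S I O := by
  classical
  let P : Concept → Prop := fun C => C.IsIn L ∧ C.IsOver S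
  let K : Set (Set ℕ) := {X | ∃ C, P C ∧ C.ext (I : Inst ℕ) = X}
  have hK : K.Finite := by
    refine (finite_adom I).finite_subsets.subset ?_
    rintro _ ⟨C, -, rfl⟩
    exact C.ext_subset_adom _
  have hrep : ∀ X : Set ℕ, ∃ C, X ∈ K → P C ∧ C.ext (I : Inst ℕ) = X := by
    intro X
    by_cases hX : X ∈ K
    · obtain ⟨C, hC⟩ := hX
      exact ⟨C, fun _ => hC⟩
    · exact ⟨Concept.top, fun h => absurd h hX⟩
  choose rep hrep using hrep
  -- The concepts with at most one constructor above representatives.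
  let B : Set Concept := {Concept.top, Concept.bot} ∪ Concept.name '' S.conceptNames ∪ rep '' K ∪
    Set.image2 Concept.conj (rep '' K) (rep '' K) ∪
    Set.image2 Concept.ex (Role.fwd '' S.roleNames ∪ Role.inv '' S.roleNames) (rep '' K)
  have hB : B.Finite := by
    have h1 := hK.image rep
    have h2 : (Role.fwd '' S.roleNames ∪ Role.inv '' S.roleNames).Finite :=
      (S.roleNames.finite_toSet.image _).union (S.roleNames.finite_toSet.image _)
    exact (((((Set.finite_singleton _).insert _).union (S.conceptNames.finite_toSet.image _)).union
      h1).union (h1.image2 _ h1)).union (h2.image2 _ h1)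
  have hfin : {ρ : TGD | ρ.IsTGD L S ∧ Sat (I : Inst ℕ) ρ ∧ ρ.lhs ∈ B ∧ ρ.rhs ∈ B}.Finite := by
    refine ((hB.prod hB).image fun p : Concept × Concept => TGD.mk p.1 p.2).subset ?_
    rintro ρ ⟨-, -, h1, h2⟩
    exact ⟨(ρ.lhs, ρ.rhs), ⟨h1, h2⟩, rfl⟩
  have hmem : ∀ X ∈ K, rep X ∈ B := fun X hX =>
    Or.inl (Or.inl (Or.inr ⟨X, hX, rfl⟩))
  refine ⟨hfin.toFinset, fun ρ hρ => ((hfin.mem_toFinset).1 hρ).1, fun ρ hρ => ⟨fun h => ?_, ?_⟩⟩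
  · exact h ℕ I fun σ hσ => ((hfin.mem_toFinset).1 hσ).2.1
  intro hI V M hM
  have heq : ∀ C D : Concept, P C → P D → C ∈ B → D ∈ B →
      C.ext (I : Inst ℕ) = D.ext (I : Inst ℕ) → C.ext M = D.ext M := by
    intro C D hC hD hCB hDB h
    refine subset_antisymm (hM ⟨C, D⟩ ?_) (hM ⟨D, C⟩ ?_)
    · exact (hfin.mem_toFinset).2 ⟨⟨⟨hC.1, hD.1⟩, hC.2, hD.2⟩, h.subset, hCB, hDB⟩
    · exact (hfin.mem_toFinset).2 ⟨⟨⟨hD.1, hC.1⟩, hD.2, hC.2⟩, h.superset, hDB, hCB⟩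
  have key : ∀ C : Concept, P C → C.ext M = (rep (C.ext (I : Inst ℕ))).ext M := by
    have hatom : ∀ C : Concept, P C → C ∈ B → C.ext M = (rep (C.ext (I : Inst ℕ))).ext M := by
      intro C hC hCB
      have hX : C.ext (I : Inst ℕ) ∈ K := ⟨C, hC, rfl⟩
      exact heq _ _ hC (hrep _ hX).1 hCB (hmem _ hX) (hrep _ hX).2.symm
    intro C hC
    induction C with
    | top => exact hatom _ hC (Or.inl (Or.inl (Or.inl (Or.inl (Or.inl rfl)))))
    | bot => exact hatom _ hC (Or.inl (Or.inl (Or.inl (Or.inl (Or.inr rfl)))))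
    | name A => exact hatom _ hC (Or.inl (Or.inl (Or.inl (Or.inr ⟨A, hC.2, rfl⟩))))
    | conj C D ihC ihD =>
      have hC' : P C := ⟨hC.1.1, hC.2.1⟩
      have hD' : P D := ⟨hC.1.2, hC.2.2⟩
      have hX : C.ext (I : Inst ℕ) ∈ K := ⟨C, hC', rfl⟩
      have hY : D.ext (I : Inst ℕ) ∈ K := ⟨D, hD', rfl⟩
      have h := hatom (Concept.conj (rep (C.ext (I : Inst ℕ))) (rep (D.ext (I : Inst ℕ))))
        ⟨⟨(hrep _ hX).1.1, (hrep _ hY).1.1⟩, (hrep _ hX).1.2, (hrep _ hY).1.2⟩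
        (Or.inl (Or.inr ⟨_, ⟨_, hX, rfl⟩, _, ⟨_, hY, rfl⟩, rfl⟩))
      simp only [Concept.ext, (hrep _ hX).2, (hrep _ hY).2] at h ⊢
      rw [ihC hC', ihD hD', h]
    | ex r C ihC =>
      have hC' : P C := ⟨hC.1.2, hC.2.2⟩
      have hX : C.ext (I : Inst ℕ) ∈ K := ⟨C, hC', rfl⟩
      have hr : r ∈ (Role.fwd '' S.roleNames ∪ Role.inv '' S.roleNames : Set Role) := by
        cases r with
        | fwd R => exact Or.inl ⟨R, hC.2.1, rfl⟩
        | inv R => exact Or.inr ⟨R, hC.2.1, rfl⟩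
      have h := hatom (Concept.ex r (rep (C.ext (I : Inst ℕ))))
        ⟨⟨hC.1.1, (hrep _ hX).1.1⟩, hC.2.1, (hrep _ hX).1.2⟩
        (Or.inr ⟨_, hr, _, ⟨_, hX, rfl⟩, rfl⟩)
      simp only [Concept.ext, (hrep _ hX).2] at h ⊢
      rw [ihC hC', h]
  have hX : ρ.lhs.ext (I : Inst ℕ) ∈ K := ⟨_, ⟨hρ.1.1, hρ.2.1⟩, rfl⟩
  have hY : ρ.rhs.ext (I : Inst ℕ) ∈ K := ⟨_, ⟨hρ.1.2, hρ.2.2⟩, rfl⟩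
  have hsub := hM ⟨rep (ρ.lhs.ext (I : Inst ℕ)), rep (ρ.rhs.ext (I : Inst ℕ))⟩
    ((hfin.mem_toFinset).2 ⟨⟨⟨(hrep _ hX).1.1, (hrep _ hY).1.1⟩, (hrep _ hX).1.2,
      (hrep _ hY).1.2⟩, by simpa only [Sat, (hrep _ hX).2, (hrep _ hY).2] using hI,
      hmem _ hX, hmem _ hY⟩)
  have h1 := key _ ⟨hρ.1.1, hρ.2.1⟩
  have h2 := key _ ⟨hρ.1.2, hρ.2.2⟩
  rw [Sat, h1, h2]
  exact hsub

/-! ### Succinct representations and depth -/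

/-- The nesting depth of existential restrictions. -/
def Concept.depth : Concept → ℕ
  | .top => 0
  | .bot => 0
  | .name _ => 0
  | .conj C D => max C.depth D.depth
  | .ex _ C => C.depth + 1

theorem Denotes.unique {g : List Node} {i : ℕ} {C D : Concept} (hC : Denotes g i C)
    (hD : Denotes g i D) : C = D := by
  induction hC generalizing D with
  | top h => cases hD <;> simp_all
  | bot h => cases hD <;> simp_all
  | name h => cases hD <;> simp_all
  | conj h _ _ ih1 ih2 =>
    cases hD with
    | conj h' h1 h2 =>
      rw [h] at h'
      simp only [Option.some.injEq, Node.conj.injEq] at h'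
      obtain ⟨rfl, rfl⟩ := h'
      rw [ih1 h1, ih2 h2]
    | _ h' => simp_all
  | ex h _ ih =>
    cases hD with
    | ex h' h1 =>
      rw [h] at h'
      simp only [Option.some.injEq, Node.ex.injEq] at h'
      obtain ⟨rfl, rfl⟩ := h'
      rw [ih h1]
    | _ h' => simp_all

theorem Denotes.lt_length {g : List Node} {i : ℕ} {C : Concept} (h : Denotes g i C) :
    i < g.length := by
  cases h <;> exact (List.getElem?_eq_some_iff.1 ‹_›).1

theorem Denotes.append {g : List Node} (l : List Node) {i : ℕ} {C : Concept}
    (h : Denotes g i C) : Denotes (g ++ l) i C := by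
  have aux : ∀ {i : ℕ} {x : Node}, g[i]? = some x → (g ++ l)[i]? = some x := by
    intro i x hx
    rw [List.getElem?_append_left (List.getElem?_eq_some_iff.1 hx).1, hx]
  induction h with
  | top h => exact .top (aux h)
  | bot h => exact .bot (aux h)
  | name h => exact .name (aux h)
  | conj h _ _ h1 h2 => exact .conj (aux h) h1 h2
  | ex h _ h1 => exact .ex (aux h) h1

theorem Denotes.exists_depth_eq {g : List Node} {i : ℕ} {C : Concept} (h : Denotes g i C) :
    ∀ k ≤ C.depth, ∃ i' C', Denotes g i' C' ∧ C'.depth = k := by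
  induction h with
  | top h => exact fun k hk => ⟨_, _, .top h, (Nat.le_zero.1 hk).symm⟩
  | bot h => exact fun k hk => ⟨_, _, .bot h, (Nat.le_zero.1 hk).symm⟩
  | name h => exact fun k hk => ⟨_, _, .name h, (Nat.le_zero.1 hk).symm⟩
  | conj _ _ _ h1 h2 =>
    intro k hk
    rcases le_max_iff.1 hk with hk | hk
    · exact h1 k hk
    · exact h2 k hk
  | ex h hC h1 =>
    intro k hk
    rcases Nat.le_succ_iff.1 hk with hk | hk
    · exact h1 k hk
    · exact ⟨_, _, .ex h hC, hk.symm⟩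

/-- The subconcepts of different depths have different nodes. -/
theorem Denotes.depth_lt_length {g : List Node} {i : ℕ} {C : Concept} (h : Denotes g i C) :
    C.depth < g.length := by
  choose! f D hD hk using h.exists_depth_eq
  have hcard : (Finset.range (C.depth + 1)).card ≤ (Finset.range g.length).card := by
    refine Finset.card_le_card_of_injOn f ?_ ?_
    · intro k hk'
      have := Finset.mem_range.1 hk'
      exact Finset.mem_coe.2 (Finset.mem_range.2 (hD k (by omega)).lt_length)
    · intro k hk' l hl' hkl
      have h1 := Finset.mem_range.1 hk'
      have h2 := Finset.mem_range.1 hl'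
      have h3 := hD k (by omega)
      rw [hkl] at h3
      rw [← hk k (by omega), ← hk l (by omega), h3.unique (hD l (by omega))]
  simpa using hcard

theorem SuccinctRep.length_nodes_le_size (G : SuccinctRep) : G.nodes.length ≤ G.size := by
  have h : ∀ l : List Node, l.length ≤ (l.flatMap Node.word).length := by
    intro l
    induction l with
    | nil => simp
    | cons x l ih =>
      have hx : 1 ≤ x.word.length := by
        cases x with
        | ex r i => cases r <;> simp [Node.word, Role.word]
        | _ => simp [Node.word]
      simp only [List.length_cons, List.flatMap_cons, List.length_append]
      omega
  rw [SuccinctRep.size, SuccinctRep.word, List.length_append]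
  exact (h _).trans (Nat.le_add_right _ _)

theorem exists_denotes (C : Concept) : ∀ g : List Node, ∃ l i, Denotes (g ++ l) i C := by
  have last : ∀ (g : List Node) (x : Node), (g ++ [x])[g.length]? = some x := by simp
  induction C with
  | top => exact fun g => ⟨[.top], g.length, .top (last _ _)⟩
  | bot => exact fun g => ⟨[.bot], g.length, .bot (last _ _)⟩
  | name A => exact fun g => ⟨[.name A], g.length, .name (last _ _)⟩
  | conj C D hC hD =>
    intro g
    obtain ⟨l1, i1, h1⟩ := hC g
    obtain ⟨l2, i2, h2⟩ := hD (g ++ l1)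
    refine ⟨l1 ++ (l2 ++ [.conj i1 i2]), (g ++ l1 ++ l2).length, ?_⟩
    rw [← List.append_assoc, ← List.append_assoc]
    exact .conj (last _ _) ((h1.append _).append _) (h2.append _)
  | ex r C hC =>
    intro g
    obtain ⟨l1, i1, h1⟩ := hC g
    refine ⟨l1 ++ [.ex r i1], (g ++ l1).length, ?_⟩
    rw [← List.append_assoc]
    exact .ex (last _ _) (h1.append _)

theorem exists_represents (O : Ontology) : ∃ G : SuccinctRep, G.Represents O := by
  classical
  induction O using Finset.induction_on with
  | empty => exact ⟨⟨[], []⟩, by simp [SuccinctRep.Represents]⟩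
  | insert ρ O _ ih =>
    obtain ⟨⟨g, incl⟩, h1, h2⟩ := ih
    obtain ⟨l1, i1, hl⟩ := exists_denotes ρ.lhs g
    obtain ⟨l2, i2, hr⟩ := exists_denotes ρ.rhs (g ++ l1)
    have hρ := And.intro (hl.append l2) hr
    refine ⟨⟨g ++ l1 ++ l2, (i1, i2) :: incl⟩, ?_, ?_⟩
    · intro p hp
      rcases List.mem_cons.1 hp with rfl | hp
      · exact ⟨ρ, Finset.mem_insert_self _ _, hρ⟩
      · obtain ⟨σ, hσ, ha, hb⟩ := h1 p hp
        exact ⟨σ, Finset.mem_insert_of_mem hσ, (ha.append _).append _, (hb.append _).append _⟩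
    · intro σ hσ
      rcases Finset.mem_insert.1 hσ with rfl | hσ
      · exact ⟨_, List.mem_cons_self, hρ⟩
      · obtain ⟨p, hp, ha, hb⟩ := h2 σ hσ
        exact ⟨p, List.mem_cons_of_mem _ hp, (ha.append _).append _, (hb.append _).append _⟩

theorem depth_le_succinctSize {O : Ontology} {ρ : TGD} (hρ : ρ ∈ O) :
    ρ.rhs.depth ≤ succinctSize O := by
  -- The infimum of the empty set would be `0`, so a representation must be known to exist.
  have hne : {k | ∃ G : SuccinctRep, G.Represents O ∧ G.size = k}.Nonempty := by
    obtain ⟨G, hG⟩ := exists_represents O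
    exact ⟨_, G, hG, rfl⟩
  obtain ⟨G, hG, hk⟩ := Nat.sInf_mem hne
  obtain ⟨p, -, -, hp⟩ := hG.2 ρ hρ
  rw [succinctSize, ← hk]
  exact hp.depth_lt_length.le.trans G.length_nodes_le_size

theorem length_word_le_ontologySize {O : Ontology} {ρ : TGD} (hρ : ρ ∈ O) :
    ρ.rhs.word.length ≤ ontologySize O := by
  refine le_trans ?_ (Finset.single_le_sum (f := TGD.size) (fun _ _ => Nat.zero_le _) hρ)
  simp only [TGD.size, TGD.word, List.length_cons, List.length_append]
  omega

/-! ### Common multiples -/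

/-- A nonzero common multiple of `1, …, 2 * M` is a multiple of `centralBinom M`: the prime powers
in `centralBinom M` are at most `2 * M`. -/
theorem two_pow_le_of_forall_dvd {M N : ℕ} (hN : N ≠ 0) (h : ∀ i < 2 * M, i + 1 ∣ N) :
    2 ^ M ≤ N := by
  have hlow : 2 ^ M ≤ M.centralBinom := by
    induction M with
    | zero => simp
    | succ M ih =>
      have h1 := Nat.succ_mul_centralBinom_succ M
      have h2 := ih fun i hi => h i (by omega)
      rw [pow_succ]
      by_contra! hlt
      have h3 : (M + 1) * (M + 1).centralBinom < (M + 1) * (2 ^ M * 2) := by gcongr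
      nlinarith [Nat.zero_le (M * M.centralBinom)]
  rcases Nat.eq_zero_or_pos M with rfl | hM
  · exact Nat.pos_of_ne_zero hN
  refine hlow.trans (Nat.le_of_dvd (Nat.pos_of_ne_zero hN) ?_)
  refine (Nat.factorization_prime_le_iff_dvd (Nat.centralBinom_ne_zero M) hN).1 fun p hp => ?_
  have hle : p ^ M.centralBinom.factorization p ≤ 2 * M :=
    Nat.pow_factorization_choose_le (by omega)
  have hpos : 0 < p ^ M.centralBinom.factorization p := pow_pos hp.pos _
  have hdvd := h (p ^ M.centralBinom.factorization p - 1) (by omega)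
  rw [Nat.sub_add_cancel hpos] at hdvd
  exact (hp.pow_dvd_iff_le_factorization hN).1 hdvd

/-! ### The two examples -/

/-- All facts over the concept name `0`, the role names `0` and `1`, and the values below `V`. -/
def allFacts (V : ℕ) : Finset (Fact ℕ) :=
  (Finset.range V).image (Fact.unary 0) ∪
    (Finset.range 2 ×ˢ Finset.range V ×ˢ Finset.range V).image
      fun t => Fact.binary t.1 t.2.1 t.2.2

/-- The facts with values below `V` that make `0` the universal point and `1` and `2` the guards,
give the guards as successors to all values `≥ 3`, and the marks and the further edges among the
latter. For the role `r`, the guard `r + 1` has the guards as successors, and the other guard,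
which is `2 - r`, has the universal point as successor. -/
def gadgetFact (mark : ℕ → Prop) (step : ℕ → ℕ → Prop) : Fact ℕ → Prop
  | .unary _ a => a = 0 ∨ (3 ≤ a ∧ mark a)
  | .binary r a b => a = 0 ∨ (a = r + 1 ∧ (b = 1 ∨ b = 2)) ∨ (a + r = 2 ∧ b = 0) ∨
      (3 ≤ a ∧ (b = 1 ∨ b = 2 ∨ (3 ≤ b ∧ step a b)))

open Classical in
/-- The instance of the facts described by `gadgetFact`. -/
noncomputable def gadget (V : ℕ) (mark : ℕ → Prop) (step : ℕ → ℕ → Prop) : FinInst :=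
  (allFacts V).filter (gadgetFact mark step)

section Gadget

variable {V W : ℕ} {mark mark' : ℕ → Prop} {step step' : ℕ → ℕ → Prop}

theorem unary_mem_gadget {A a : ℕ} : Fact.unary A a ∈ (gadget V mark step : Inst ℕ) ↔
    A = 0 ∧ a < V ∧ (a = 0 ∨ (3 ≤ a ∧ mark a)) := by
  simp only [gadget, Finset.coe_filter, Set.mem_ofPred_eq, allFacts, gadgetFact, Finset.mem_union,
    Finset.mem_image, Finset.mem_range, Finset.mem_product, Fact.unary.injEq, reduceCtorEq,
    and_false, exists_false, or_false]
  constructor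
  · rintro ⟨⟨_, h, rfl, rfl⟩, h'⟩
    exact ⟨rfl, h, h'⟩
  · rintro ⟨rfl, h, h'⟩
    exact ⟨⟨a, h, rfl, rfl⟩, h'⟩

theorem binary_mem_gadget {r a b : ℕ} : Fact.binary r a b ∈ (gadget V mark step : Inst ℕ) ↔
    r < 2 ∧ a < V ∧ b < V ∧ (a = 0 ∨ (a = r + 1 ∧ (b = 1 ∨ b = 2)) ∨ (a + r = 2 ∧ b = 0) ∨
      (3 ≤ a ∧ (b = 1 ∨ b = 2 ∨ (3 ≤ b ∧ step a b)))) := by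
  simp only [gadget, Finset.coe_filter, Set.mem_ofPred_eq, allFacts, gadgetFact, Finset.mem_union,
    Finset.mem_image, Finset.mem_range, Finset.mem_product, Fact.binary.injEq, reduceCtorEq,
    and_false, exists_false, false_or, Prod.exists]
  constructor
  · rintro ⟨⟨_, _, _, h, rfl, rfl, rfl⟩, h'⟩
    exact ⟨h.1, h.2.1, h.2.2, h'⟩
  · rintro ⟨h1, h2, h3, h'⟩
    exact ⟨⟨r, a, b, ⟨h1, h2, h3⟩, rfl, rfl, rfl⟩, h'⟩

theorem isHom_zero (hW : 0 < W) :
    IsHom (fun _ => 0) (gadget V mark step : Inst ℕ) (gadget W mark' step' : Inst ℕ) := by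
  refine ⟨fun A a h => ?_, fun r a b h => ?_⟩
  · rw [unary_mem_gadget] at h ⊢
    exact ⟨h.1, hW, Or.inl rfl⟩
  · rw [binary_mem_gadget] at h ⊢
    exact ⟨h.1, hW, hW, Or.inl rfl⟩

/-- All values `≥ 3` can be collapsed to the universal point. -/
theorem isHom_collapse (hW : 3 ≤ W) : IsHom (fun a => if 3 ≤ a then 0 else a)
    (gadget V mark step : Inst ℕ) (gadget W mark' step' : Inst ℕ) := by
  refine ⟨fun A a h => ?_, fun r a b h => ?_⟩
  · rw [unary_mem_gadget] at h ⊢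
    grind
  · rw [binary_mem_gadget] at h ⊢
    grind

/-- The universal point satisfies every concept that is satisfied anywhere. -/
theorem zero_mem_ext {C : Concept} {d : ℕ} (hV : 0 < V)
    (hd : d ∈ C.ext (gadget V mark step : Inst ℕ)) : 0 ∈ C.ext (gadget V mark step : Inst ℕ) :=
  (isHom_zero hV).mem_ext C hd

/-- Inverse roles lead back to the universal point, so they distinguish no two values. -/
theorem mem_ext_ex_inv {C : Concept} {r d e : ℕ}
    (hd : d ∈ (Concept.ex (.inv r) C).ext (gadget V mark step : Inst ℕ)) (he : e < V) :
    e ∈ (Concept.ex (.inv r) C).ext (gadget V mark step : Inst ℕ) := by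
  obtain ⟨c, hc, hcC⟩ := hd
  have hr := (binary_mem_gadget.1 hc).1
  have hV : 0 < V := by omega
  exact ⟨0, binary_mem_gadget.2 ⟨hr, hV, he, Or.inl rfl⟩, zero_mem_ext hV hcC⟩

theorem mem_adom_gadget {d : ℕ} (hd : d < V) : d ∈ adom (gadget V mark step : Inst ℕ) :=
  ⟨_, binary_mem_gadget.2 ⟨Nat.zero_lt_two, Nat.zero_lt_of_lt hd, hd, Or.inl rfl⟩, Or.inr rfl⟩

theorem instSize_gadget_le :
    instSize (gadget V mark step) ≤ (V + 2 * V ^ 2) * (5 + 2 * V) + 1 := by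
  have hnum : ∀ {k l : ℕ}, k < 2 ^ l → (numWord k).length ≤ l + 1 := by
    intro k l h
    simpa [numWord, Nat.size_eq_bits_len] using Nat.size_le.2 h
  have hvalue : ∀ {k : ℕ}, k < V → (numWord k).length ≤ V + 1 := fun h =>
    hnum (h.trans V.lt_two_pow_self)
  have hcard : (allFacts V).card ≤ V + 2 * V ^ 2 := by
    refine (Finset.card_union_le _ _).trans (Nat.add_le_add ?_ ?_)
    · exact Finset.card_image_le.trans (by simp)
    · exact Finset.card_image_le.trans (by simp [sq])
  have hword : ∀ φ ∈ gadget V mark step, φ.word.length ≤ 5 + 2 * V := by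
    intro φ hφ
    cases φ with
    | unary A a =>
      obtain ⟨rfl, ha, -⟩ := unary_mem_gadget.1 (Finset.mem_coe.2 hφ)
      have h1 := hnum (k := 0) (l := 0) (by simp)
      have h2 := hvalue ha
      simp only [Fact.word, List.length_cons, List.length_append]
      omega
    | binary r a b =>
      obtain ⟨hr, ha, hb, -⟩ := binary_mem_gadget.1 (Finset.mem_coe.2 hφ)
      have h1 := hnum (k := r) (l := 1) (by simpa using hr)
      have h2 := hvalue ha
      have h3 := hvalue hb
      simp only [Fact.word, List.length_cons, List.length_append]
      omega
  have hsum := Finset.sum_le_card_nsmul _ _ _ hword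
  have hsub : (gadget V mark step).card ≤ (allFacts V).card :=
    Finset.card_le_card (by classical exact Finset.filter_subset _ _)
  simp only [instSize, List.length_singleton]
  rw [smul_eq_mul] at hsum
  exact Nat.add_le_add_right (hsum.trans (Nat.mul_le_mul_right _ (hsub.trans hcard))) 1

end Gadget

/-- Position `k`, taken modulo the length, of the cycle of length `i + 1`. -/
def cyclePoint (i k : ℕ) : ℕ := 3 + Nat.pair i (k % (i + 1))

/-- The positive example: the gadget with the cycles of lengths `1, …, m`, whose edges carry both
roles. The value `3 + Nat.pair i k` encodes position `k` of the cycle of length `i + 1`, and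
position `0` is marked. -/
noncomputable def cycles (m : ℕ) : FinInst :=
  gadget (3 + m ^ 2) (fun a => (Nat.unpair (a - 3)).2 = 0)
    fun a b => b = cyclePoint (Nat.unpair (a - 3)).1 ((Nat.unpair (a - 3)).2 + 1)

/-- The negative example: the gadget with one additional value, `3`, which is marked. -/
noncomputable def star : FinInst := gadget 4 (fun _ => True) fun _ _ => False

theorem unary_three_mem_star : Fact.unary 0 3 ∈ (star : Inst ℕ) :=
  unary_mem_gadget.2 ⟨rfl, by omega, Or.inr ⟨le_rfl, trivial⟩⟩

theorem cyclePoint_lt {m i : ℕ} (hi : i < m) (k : ℕ) : cyclePoint i k < 3 + m ^ 2 := by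
  have h1 : k % (i + 1) < i + 1 := Nat.mod_lt _ i.succ_pos
  have h2 := Nat.pair_lt_max_add_one_sq i (k % (i + 1))
  rw [max_eq_left (by omega)] at h2
  have h3 : (i + 1) ^ 2 ≤ m ^ 2 := Nat.pow_le_pow_left hi 2
  rw [cyclePoint]
  omega

theorem three_le_cyclePoint (i k : ℕ) : 3 ≤ cyclePoint i k := Nat.le_add_right _ _

theorem unary_cyclePoint_mem {m i A k : ℕ} (hi : i < m) :
    Fact.unary A (cyclePoint i k) ∈ (cycles m : Inst ℕ) ↔ A = 0 ∧ i + 1 ∣ k := by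
  have h3 := three_le_cyclePoint i k
  have h0 : cyclePoint i k ≠ 0 := by omega
  rw [cycles, unary_mem_gadget]
  simp only [cyclePoint_lt hi, h3, h0, true_and, false_or]
  simp [cyclePoint, Nat.dvd_iff_mod_eq_zero]

theorem binary_cyclePoint_mem {m i r k b : ℕ} (hi : i < m) :
    Fact.binary r (cyclePoint i k) b ∈ (cycles m : Inst ℕ) ↔
      r < 2 ∧ (b = 1 ∨ b = 2 ∨ b = cyclePoint i (k + 1)) := by
  have h3 := three_le_cyclePoint i k
  have h3' := three_le_cyclePoint i (k + 1)
  have hlt := cyclePoint_lt hi (k + 1)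
  have hm : 1 ≤ m ^ 2 := Nat.one_le_pow _ _ (by omega)
  have hstep : cyclePoint (Nat.unpair (cyclePoint i k - 3)).1
      ((Nat.unpair (cyclePoint i k - 3)).2 + 1) = cyclePoint i (k + 1) := by
    simp [cyclePoint]
  rw [cycles, binary_mem_gadget, hstep]
  have := cyclePoint_lt hi k
  constructor
  · rintro ⟨hr, -, -, h⟩
    refine ⟨hr, ?_⟩
    omega
  · rintro ⟨hr, h⟩
    refine ⟨hr, this, ?_, ?_⟩ <;> omega

/-! ### The lower bound -/

theorem one_le_length_word (C : Concept) : 1 ≤ C.word.length := by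
  cases C with
  | ex r C => cases r <;> simp [Concept.word, Role.word]
  | _ => simp [Concept.word]

theorem length_word_ex_le (r : Role) (C : Concept) :
    C.word.length ≤ (Concept.ex r C).word.length := by
  simp [Concept.word]

/-- A concept that holds at position `j` of all cycles and fails at both guards contains a full
binary tree of some depth `h` such that after `h` steps the marks of all cycles are reached
simultaneously. If it fails at one guard, then it has a branch of this kind that starts with the
role that leads that guard to the guards. -/
theorem branching_of_forall_mem {m : ℕ} (hm : 0 < m) (C : Concept) :
    ∀ j, (∀ i < m, cyclePoint i j ∈ C.ext (cycles m : Inst ℕ)) →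
      (∀ g, (g = 1 ∨ g = 2) → g ∉ C.ext (cycles m : Inst ℕ) → (∀ i < m, i + 1 ∣ j) ∨
        ∃ h, (∀ i < m, i + 1 ∣ j + 1 + h) ∧ 2 ^ h ≤ C.word.length ∧ h + 1 ≤ C.depth) ∧
      (1 ∉ C.ext (cycles m : Inst ℕ) → 2 ∉ C.ext (cycles m : Inst ℕ) →
        ∃ h, (∀ i < m, i + 1 ∣ j + h) ∧ 2 ^ h ≤ C.word.length ∧ h ≤ C.depth) := by
  have hV : 1 ≤ m ^ 2 := Nat.one_le_pow _ _ hm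
  have hzero : ∀ (C : Concept) (j : ℕ), (∀ i < m, i + 1 ∣ j) →
      ∃ h, (∀ i < m, i + 1 ∣ j + h) ∧ 2 ^ h ≤ C.word.length ∧ h ≤ C.depth := fun C j h =>
    ⟨0, h, by simpa using one_le_length_word C, Nat.zero_le _⟩
  induction C with
  | top =>
    have htop : ∀ g, (g = 1 ∨ g = 2) → g ∈ Concept.top.ext (cycles m : Inst ℕ) := fun g hg =>
      mem_adom_gadget (by omega)
    exact fun j _ => ⟨fun g hg h => absurd (htop g hg) h, fun h => absurd (htop 1 (.inl rfl)) h⟩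
  | bot => exact fun j h => (h 0 hm).elim
  | name A =>
    intro j h
    have hj : ∀ i < m, i + 1 ∣ j := fun i hi => ((unary_cyclePoint_mem hi).1 (h i hi)).2
    exact ⟨fun _ _ _ => Or.inl hj, fun _ _ => hzero _ _ hj⟩
  | conj C D ihC ihD =>
    intro j h
    obtain ⟨hC1, hC2⟩ := ihC j fun i hi => (h i hi).1
    obtain ⟨hD1, hD2⟩ := ihD j fun i hi => (h i hi).2
    have hlen : (Concept.conj C D).word.length = C.word.length + D.word.length + 1 := by
      simp [Concept.word]
    have hdep : (Concept.conj C D).depth = max C.depth D.depth := rfl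
    have hnot : ∀ g, g ∉ (Concept.conj C D).ext (cycles m : Inst ℕ) →
        g ∉ C.ext (cycles m : Inst ℕ) ∨ g ∉ D.ext (cycles m : Inst ℕ) := fun g hg =>
      not_and_or.1 hg
    refine ⟨fun g hg hgC => ?_, fun h1 h2 => ?_⟩
    · rcases hnot g hgC with hg' | hg'
      · refine (hC1 g hg hg').imp_right fun ⟨k, hk, hk1, hk2⟩ => ⟨k, hk, ?_, ?_⟩ <;> omega
      · refine (hD1 g hg hg').imp_right fun ⟨k, hk, hk1, hk2⟩ => ⟨k, hk, ?_, ?_⟩ <;> omega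
    -- Two conjuncts, each of which fails at one guard only, yield the two subtrees of a tree.
    have hmix : ∀ g g', (g = 1 ∨ g = 2) → (g' = 1 ∨ g' = 2) → g ∉ C.ext (cycles m : Inst ℕ) →
        g' ∉ D.ext (cycles m : Inst ℕ) → ∃ h, (∀ i < m, i + 1 ∣ j + h) ∧
          2 ^ h ≤ (Concept.conj C D).word.length ∧ h ≤ (Concept.conj C D).depth := by
      intro g g' hg hg' hgC hgD
      rcases hC1 g hg hgC with hj | ⟨k, hk, hk1, hk2⟩
      · exact hzero _ _ hj
      rcases hD1 g' hg' hgD with hj | ⟨l, hl, hl1, hl2⟩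
      · exact hzero _ _ hj
      rcases le_total k l with hkl | hkl
      · have hpow : 2 ^ k ≤ 2 ^ l := Nat.pow_le_pow_right two_pos hkl
        refine ⟨k + 1, fun i hi => ?_, ?_, ?_⟩
        · simpa only [add_assoc, add_comm 1 k] using hk i hi
        · rw [pow_succ]
          omega
        · omega
      · have hpow : 2 ^ l ≤ 2 ^ k := Nat.pow_le_pow_right two_pos hkl
        refine ⟨l + 1, fun i hi => ?_, ?_, ?_⟩
        · simpa only [add_assoc, add_comm 1 l] using hl i hi
        · rw [pow_succ]
          omega
        · omega
    rcases hnot 1 h1 with h1 | h1 <;> rcases hnot 2 h2 with h2 | h2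
    · obtain ⟨k, hk, hk1, hk2⟩ := hC2 h1 h2
      exact ⟨k, hk, by omega, by omega⟩
    · exact hmix 1 2 (.inl rfl) (.inr rfl) h1 h2
    · exact hmix 2 1 (.inr rfl) (.inl rfl) h2 h1
    · obtain ⟨k, hk, hk1, hk2⟩ := hD2 h1 h2
      exact ⟨k, hk, by omega, by omega⟩
  | ex r C ih =>
    intro j h
    cases r with
    | inv r =>
      have hinv : ∀ g, (g = 1 ∨ g = 2) → g ∈ (Concept.ex (.inv r) C).ext (cycles m : Inst ℕ) :=
        fun g hg => mem_ext_ex_inv (h 0 hm) (by omega)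
      exact ⟨fun g hg hg' => absurd (hinv g hg) hg', fun h1 => absurd (hinv 1 (.inl rfl)) h1⟩
    | fwd r =>
      obtain ⟨b, hb, hbC⟩ := h 0 hm
      have hr : r < 2 := ((binary_cyclePoint_mem hm).1 hb).1
      have h0 : 0 ∈ C.ext (cycles m : Inst ℕ) := zero_mem_ext (by omega) hbC
      -- The guard `2 - r` has the universal point as successor.
      have hother : ∀ g, g + r = 2 → g ∈ (Concept.ex (.fwd r) C).ext (cycles m : Inst ℕ) :=
        fun g hg => ⟨0, binary_mem_gadget.2 ⟨hr, by omega, by omega, by omega⟩, h0⟩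
      refine ⟨fun g hg hgC => ?_, fun h1 h2 => ?_⟩
      · have hg' : g = r + 1 := by
          by_contra hne
          exact hgC (hother g (by omega))
        have hsucc : ∀ b, (b = 1 ∨ b = 2) → b ∉ C.ext (cycles m : Inst ℕ) := fun b hb hbC =>
          hgC ⟨b, binary_mem_gadget.2 ⟨hr, by omega, by omega, by omega⟩, hbC⟩
        have hnext : ∀ i < m, cyclePoint i (j + 1) ∈ C.ext (cycles m : Inst ℕ) := by
          intro i hi
          obtain ⟨c, hc, hcC⟩ := h i hi
          rcases ((binary_cyclePoint_mem hi).1 hc).2 with rfl | rfl | rfl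
          · exact absurd hcC (hsucc 1 (.inl rfl))
          · exact absurd hcC (hsucc 2 (.inr rfl))
          · exact hcC
        obtain ⟨k, hk, hk1, hk2⟩ := (ih (j + 1) hnext).2 (hsucc 1 (.inl rfl)) (hsucc 2 (.inr rfl))
        exact Or.inr ⟨k, hk, hk1.trans (length_word_ex_le _ _), Nat.succ_le_succ hk2⟩
      · obtain hr | hr : r = 0 ∨ r = 1 := by omega
        · exact absurd (hother 2 (by omega)) h2
        · exact absurd (hother 1 (by omega)) h1

/-- A concept that holds at position `0` of all cycles but fails at the marked value of `star` has
an existential restriction whose argument branches as in `branching_of_forall_mem`. -/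
theorem large_of_mem_cycles_of_notMem_star {m : ℕ} (hm : 0 < m) (D : Concept)
    (h1 : ∀ i < m, cyclePoint i 0 ∈ D.ext (cycles m : Inst ℕ))
    (h2 : 3 ∉ D.ext (star : Inst ℕ)) :
    ∃ h, (∀ i < m, i + 1 ∣ h + 1) ∧ 2 ^ h ≤ D.word.length ∧ h + 1 ≤ D.depth := by
  have hV : 1 ≤ m ^ 2 := Nat.one_le_pow _ _ hm
  induction D with
  | top => exact absurd (mem_adom_gadget (by omega)) h2
  | bot => exact (h1 0 hm).elim
  | name A =>
    obtain ⟨rfl, -⟩ := (unary_cyclePoint_mem hm).1 (h1 0 hm)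
    exact absurd unary_three_mem_star h2
  | conj C D hC hD =>
    have hlen : (Concept.conj C D).word.length = C.word.length + D.word.length + 1 := by
      simp [Concept.word]
    have hdep : (Concept.conj C D).depth = max C.depth D.depth := rfl
    rcases not_and_or.1 h2 with h2 | h2
    · obtain ⟨k, hk, hk1, hk2⟩ := hC (fun i hi => (h1 i hi).1) h2
      exact ⟨k, hk, by omega, by omega⟩
    · obtain ⟨k, hk, hk1, hk2⟩ := hD (fun i hi => (h1 i hi).2) h2
      exact ⟨k, hk, by omega, by omega⟩
  | ex r C _ =>
    obtain ⟨b, hb, hbC⟩ := h1 0 hm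
    cases r with
    | inv r =>
      have hr : r < 2 := (binary_mem_gadget.1 hb).1
      exact absurd ⟨0, binary_mem_gadget.2 ⟨hr, by omega, by omega, Or.inl rfl⟩,
        (isHom_zero (by omega)).mem_ext C hbC⟩ h2
    | fwd r =>
      have hr : r < 2 := (binary_mem_gadget.1 hb).1
      have hsucc : ∀ g, (g = 1 ∨ g = 2) → g ∉ C.ext (cycles m : Inst ℕ) := by
        intro g hg hgC
        have hcol := (isHom_collapse (W := 4) (mark' := fun _ => True) (step' := fun _ _ => False)
          (by omega)).mem_ext C hgC
        rw [if_neg (by omega)] at hcol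
        exact h2 ⟨g, binary_mem_gadget.2 ⟨hr, by omega, by omega, by omega⟩, hcol⟩
      have hnext : ∀ i < m, cyclePoint i 1 ∈ C.ext (cycles m : Inst ℕ) := by
        intro i hi
        obtain ⟨c, hc, hcC⟩ := h1 i hi
        rcases ((binary_cyclePoint_mem hi).1 hc).2 with rfl | rfl | rfl
        · exact absurd hcC (hsucc 1 (.inl rfl))
        · exact absurd hcC (hsucc 2 (.inr rfl))
        · exact hcC
      obtain ⟨k, hk, hk1, hk2⟩ := (branching_of_forall_mem hm C 1 hnext).2
        (hsucc 1 (.inl rfl)) (hsucc 2 (.inr rfl))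
      exact ⟨k, fun i hi => by simpa only [add_comm] using hk i hi,
        hk1.trans (length_word_ex_le _ _), Nat.succ_le_succ hk2⟩

/-- The marked value of `star` can be mapped to position `0` of any cycle. -/
theorem isHom_star_cycles {m i : ℕ} (hi : i < m) :
    IsHom (fun a => if a = 3 then cyclePoint i 0 else a) (star : Inst ℕ) (cycles m : Inst ℕ) := by
  have hV : 1 ≤ m ^ 2 := Nat.one_le_pow _ _ (by omega)
  have hlt := cyclePoint_lt hi 0
  have hmark := (unary_cyclePoint_mem (m := m) (A := 0) (k := 0) hi).2 ⟨rfl, dvd_zero _⟩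
  refine ⟨fun A a h => ?_, fun r a b h => ?_⟩
  · obtain ⟨rfl, ha, h⟩ := unary_mem_gadget.1 h
    beta_reduce
    split_ifs with h3
    · exact hmark
    · exact unary_mem_gadget.2 ⟨rfl, by omega, by omega⟩
  · obtain ⟨hr, ha, hb, h⟩ := binary_mem_gadget.1 h
    beta_reduce
    by_cases h3 : a = 3
    · subst h3
      have hguard : b = 1 ∨ b = 2 := by
        simp only [and_false, or_false] at h
        omega
      rw [if_pos rfl, if_neg (by omega)]
      exact (binary_cyclePoint_mem hi).2 ⟨hr, by omega⟩
    · rw [if_neg h3]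
      refine binary_mem_gadget.2 ⟨hr, by omega, ?_, ?_⟩ <;> split_ifs <;> omega

/-- An inclusion that holds in `cycles m` but not in `star` is violated at the marked value of
`star`, and its right-hand side is large. -/
theorem large_of_sat_of_not_sat {m : ℕ} (hm : 0 < m) {ρ : TGD} (h1 : Sat (cycles m : Inst ℕ) ρ)
    (h2 : ¬ Sat (star : Inst ℕ) ρ) :
    ∃ h, (∀ i < m, i + 1 ∣ h + 1) ∧ 2 ^ h ≤ ρ.rhs.word.length ∧ h + 1 ≤ ρ.rhs.depth := by
  obtain ⟨d, hdC, hdD⟩ := Set.not_subset.1 h2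
  have hd : d < 4 := by
    obtain ⟨φ, hφ, hd⟩ := ρ.lhs.ext_subset_adom _ hdC
    cases φ with
    | unary A a =>
      have := unary_mem_gadget.1 hφ
      obtain rfl : d = a := hd
      omega
    | binary R a b =>
      have := binary_mem_gadget.1 hφ
      rcases hd with rfl | rfl <;> omega
  have hmem : ∀ i < m, (if d = 3 then cyclePoint i 0 else d) ∈ ρ.rhs.ext (cycles m : Inst ℕ) :=
    fun i hi => h1 ((isHom_star_cycles hi).mem_ext _ hdC)
  obtain rfl : d = 3 := by
    by_contra hne
    have h := hmem 0 hm
    rw [if_neg hne] at h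
    have hcol := (isHom_collapse (W := 4) (mark' := fun _ => True) (step' := fun _ _ => False)
      (by omega)).mem_ext _ h
    rw [if_neg (by omega)] at hcol
    exact hdD hcol
  exact large_of_mem_cycles_of_notMem_star hm _ (fun i hi => by simpa using hmem i hi) hdD

theorem ontology_lower_bound {n : ℕ} {O : Ontology}
    (h1 : IsModel (cycles (2 * (n + 1)) : Inst ℕ) O) (h2 : ¬ IsModel (star : Inst ℕ) O) :
    2 ^ 2 ^ n ≤ ontologySize O ∧ 2 ^ n ≤ succinctSize O := by
  obtain ⟨ρ, hρ, hstar⟩ : ∃ ρ ∈ O, ¬ Sat (star : Inst ℕ) ρ := by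
    simpa [IsModel] using h2
  obtain ⟨h, hdvd, hlen, hdep⟩ := large_of_sat_of_not_sat (by omega) (h1 ρ hρ) hstar
  have hh := two_pow_le_of_forall_dvd h.succ_ne_zero hdvd
  have hn : 1 ≤ 2 ^ n := Nat.one_le_two_pow
  rw [pow_succ] at hh
  have hpow : 2 ^ 2 ^ n ≤ 2 ^ h := Nat.pow_le_pow_right two_pos (by omega)
  exact ⟨hpow.trans (hlen.trans (length_word_le_ontologySize hρ)),
    le_trans (by omega) (depth_le_succinctSize hρ)⟩

/-! ### The tree inclusion -/

/-- The full binary tree of depth `k` over the roles `0` and `1` with the concept name `0` at its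
leaves. -/
def treeConcept : ℕ → Concept
  | 0 => .name 0
  | k + 1 => .conj (.ex (.fwd 0) (treeConcept k)) (.ex (.fwd 1) (treeConcept k))

/-- The inclusion of the marks in the tree whose depth is a multiple of the lengths of all cycles
of `cycles m`. -/
def treeTGD (m : ℕ) : TGD := ⟨.name 0, treeConcept m.factorial⟩

theorem treeTGD_isTGD (L : DL) {S : Schema} (m : ℕ) (h : 0 ∈ S.conceptNames)
    (h0 : 0 ∈ S.roleNames) (h1 : 1 ∈ S.roleNames) : (treeTGD m).IsTGD L S := by
  have hin : ∀ k, (treeConcept k).IsIn L := by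
    intro k
    induction k with
    | zero => trivial
    | succ k ih => exact ⟨⟨trivial, ih⟩, trivial, ih⟩
  have hover : ∀ k, (treeConcept k).IsOver S := by
    intro k
    induction k with
    | zero => exact h
    | succ k ih => exact ⟨⟨h0, ih⟩, h1, ih⟩
  exact ⟨⟨trivial, hin _⟩, h, hover _⟩

theorem zero_mem_treeConcept {V : ℕ} {mark : ℕ → Prop} {step : ℕ → ℕ → Prop} (hV : 0 < V)
    (k : ℕ) : 0 ∈ (treeConcept k).ext (gadget V mark step : Inst ℕ) := by
  induction k with
  | zero => exact unary_mem_gadget.2 ⟨rfl, hV, Or.inl rfl⟩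
  | succ k ih =>
    exact ⟨⟨0, binary_mem_gadget.2 ⟨by omega, hV, hV, Or.inl rfl⟩, ih⟩,
      0, binary_mem_gadget.2 ⟨by omega, hV, hV, Or.inl rfl⟩, ih⟩

theorem cyclePoint_mem_treeConcept {m i : ℕ} (hi : i < m) (k : ℕ) :
    ∀ j, i + 1 ∣ j + k → cyclePoint i j ∈ (treeConcept k).ext (cycles m : Inst ℕ) := by
  induction k with
  | zero => exact fun j h => (unary_cyclePoint_mem hi).2 ⟨rfl, h⟩
  | succ k ih =>
    intro j h
    have hnext := ih (j + 1) (by simpa only [add_assoc, add_comm 1 k] using h)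
    exact ⟨⟨_, (binary_cyclePoint_mem hi).2 ⟨by omega, .inr (.inr rfl)⟩, hnext⟩,
      _, (binary_cyclePoint_mem hi).2 ⟨by omega, .inr (.inr rfl)⟩, hnext⟩

theorem sat_cycles_treeTGD (m : ℕ) : Sat (cycles m : Inst ℕ) (treeTGD m) := by
  intro d hd
  have hd' : Fact.unary 0 d ∈ (cycles m : Inst ℕ) := hd
  obtain ⟨-, hlt, rfl | ⟨h3, hmark⟩⟩ := unary_mem_gadget.1 hd'
  · exact zero_mem_treeConcept (by omega) _
  · have hi : (Nat.unpair (d - 3)).1 < m := by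
      by_contra! hle
      have h := Nat.add_le_pair (Nat.unpair (d - 3)).1 (Nat.unpair (d - 3)).2
      have hsq : Nat.pair (Nat.unpair (d - 3)).1 0 = (Nat.unpair (d - 3)).1 ^ 2 +
          (Nat.unpair (d - 3)).1 := by simp [Nat.pair, sq]
      have hpair := Nat.pair_unpair (d - 3)
      rw [hmark, hsq] at hpair
      have := Nat.pow_le_pow_left hle 2
      omega
    have hd3 : d = cyclePoint (Nat.unpair (d - 3)).1 0 := by
      have hpair := Nat.pair_unpair (d - 3)
      rw [hmark] at hpair
      rw [cyclePoint, Nat.zero_mod, hpair]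
      omega
    rw [hd3]
    refine cyclePoint_mem_treeConcept hi _ 0 ?_
    rw [Nat.zero_add]
    exact Nat.dvd_factorial (Nat.succ_pos _) hi

theorem not_sat_star_treeTGD (m : ℕ) : ¬ Sat (star : Inst ℕ) (treeTGD m) := by
  have hguard : ∀ k, 1 ∉ (treeConcept k).ext (star : Inst ℕ) ∧
      2 ∉ (treeConcept k).ext (star : Inst ℕ) := by
    intro k
    induction k with
    | zero =>
      refine ⟨fun h => ?_, fun h => ?_⟩
      · have := unary_mem_gadget.1 (show Fact.unary 0 1 ∈ (star : Inst ℕ) from h)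
        omega
      · have := unary_mem_gadget.1 (show Fact.unary 0 2 ∈ (star : Inst ℕ) from h)
        omega
    | succ k ih =>
      constructor
      · rintro ⟨⟨b, hb, hbC⟩, -⟩
        have := binary_mem_gadget.1 hb
        obtain rfl | rfl : b = 1 ∨ b = 2 := by omega
        · exact ih.1 hbC
        · exact ih.2 hbC
      · rintro ⟨-, b, hb, hbC⟩
        have := binary_mem_gadget.1 hb
        obtain rfl | rfl : b = 1 ∨ b = 2 := by omega
        · exact ih.1 hbC
        · exact ih.2 hbC
  intro h
  have hmark : 3 ∈ (Concept.name 0).ext (star : Inst ℕ) := unary_three_mem_star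
  have htree : 3 ∈ (treeConcept m.factorial).ext (star : Inst ℕ) := h hmark
  obtain ⟨k, hk⟩ := Nat.exists_eq_succ_of_ne_zero m.factorial_ne_zero
  rw [hk] at htree
  obtain ⟨⟨b, hb, hbC⟩, -⟩ := htree
  have := (binary_mem_gadget.1 hb).2.2.2
  obtain rfl | rfl : b = 1 ∨ b = 2 := by simp only [and_false, or_false] at this; omega
  · exact (hguard k).1 hbC
  · exact (hguard k).2 hbC

theorem unary_zero_mem_cycles (m : ℕ) : Fact.unary 0 0 ∈ (cycles m : Inst ℕ) :=
  unary_mem_gadget.2 ⟨rfl, by omega, Or.inl rfl⟩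

theorem binary_zero_mem_cycles (m : ℕ) {r : ℕ} (hr : r < 2) :
    Fact.binary r 0 0 ∈ (cycles m : Inst ℕ) :=
  binary_mem_gadget.2 ⟨hr, by omega, by omega, Or.inl rfl⟩

/-- The fitting instance with the positive example `cycles m` and the negative example `star`. -/
noncomputable def cyclesStar (m : ℕ) : FittingInstance where
  pos := {cycles m}
  neg := {star}
  pos_nonempty := Finset.singleton_nonempty _
  neg_nonempty := Finset.singleton_nonempty _

theorem fitsTGD_treeTGD (L : DL) (m : ℕ) : FitsTGD L (cyclesStar m) (treeTGD m) := by
  have hrole : ∀ r < 2, r ∈ (cyclesStar m).schema.roleNames := by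
    intro r hr
    refine Finset.mem_biUnion.2 ⟨cycles m, by simp [cyclesStar], Finset.mem_biUnion.2
      ⟨_, Finset.mem_coe.1 (binary_zero_mem_cycles m hr), by simp [Fact.roleNames]⟩⟩
  refine ⟨treeTGD_isTGD L m ?_ (hrole 0 (by omega)) (hrole 1 (by omega)), ?_, ?_⟩
  · exact Finset.mem_biUnion.2 ⟨cycles m, by simp [cyclesStar], Finset.mem_biUnion.2
      ⟨_, Finset.mem_coe.1 (unary_zero_mem_cycles m), by simp [Fact.conceptNames]⟩⟩
  · simpa [cyclesStar] using sat_cycles_treeTGD m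
  · simpa [cyclesStar] using not_sat_star_treeTGD m

theorem FitsTGD.fitsOntology_singleton {L : DL} {E : FittingInstance} {ρ : TGD}
    (h : FitsTGD L E ρ) : FitsOntology L E {ρ} := by
  simpa [FitsOntology, FitsTGD, IsOntology, IsModel] using h

theorem fitsOntology_lower_bound {L : DL} {n : ℕ} {O : Ontology}
    (h : FitsOntology L (cyclesStar (2 * (n + 1))) O) :
    2 ^ 2 ^ n ≤ ontologySize O ∧ 2 ^ n ≤ succinctSize O :=
  ontology_lower_bound (h.2.1 _ (Finset.mem_singleton_self _))
    (h.2.2 _ (Finset.mem_singleton_self _))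

theorem isFiniteBasis_lower_bound {L : DL} {n : ℕ} {S : Schema} {O : Ontology}
    (hS : Inst.IsOver S (cycles (2 * (n + 1)) : Inst ℕ))
    (h : IsFiniteBasis L S (cycles (2 * (n + 1))) O) :
    2 ^ 2 ^ n ≤ ontologySize O ∧ 2 ^ n ≤ succinctSize O := by
  refine ontology_lower_bound (fun ρ hρ => ?_) fun hstar => ?_
  · exact (h.2 ρ (h.1 ρ hρ)).1 fun V M hM => hM ρ hρ
  · have htgd := treeTGD_isTGD L (2 * (n + 1)) (hS _ (unary_zero_mem_cycles _))
      (hS _ (binary_zero_mem_cycles _ (r := 0) (by omega)))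
      (hS _ (binary_zero_mem_cycles _ (r := 1) (by omega)))
    exact not_sat_star_treeTGD _ ((h.2 _ htgd).2 (sat_cycles_treeTGD _) ℕ _ hstar)

/-- A polynomial bound for the size of a gadget with `V.eval n` values. -/
noncomputable def sizeBound (V : Polynomial ℕ) : Polynomial ℕ :=
  (V + 2 * V ^ 2) * (5 + 2 * V) + 1

theorem instSize_cycles_le (n : ℕ) : instSize (cycles (2 * (n + 1))) ≤
    (sizeBound (3 + (2 * (Polynomial.X + 1)) ^ 2)).eval n := by
  refine instSize_gadget_le.trans (le_of_eq ?_)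
  simp [sizeBound]

theorem instSize_star_le (n : ℕ) : instSize star ≤ (sizeBound 4).eval n := by
  refine instSize_gadget_le.trans (le_of_eq ?_)
  simp [sizeBound]

end DLFit

theorem mainTheorem4 (L : DL) :
    (∃ p : Polynomial ℕ, ∀ n : ℕ, 1 ≤ n →
      ∃ E : FittingInstance,
        E.size ≤ p.eval n ∧
        (∃ ρ : TGD, FitsTGD L E ρ) ∧
        (∃ O : Ontology, FitsOntology L E O) ∧
        (∀ ρ : TGD, FitsTGD L E ρ →
          2 ^ 2 ^ n ≤ ρ.size ∧ 2 ^ n ≤ succinctSize {ρ}) ∧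
        (∀ O : Ontology, FitsOntology L E O →
          2 ^ 2 ^ n ≤ ontologySize O ∧ 2 ^ n ≤ succinctSize O)) ∧
    (∃ p : Polynomial ℕ, ∀ n : ℕ, 1 ≤ n →
      ∃ I : FinInst,
        instSize I ≤ p.eval n ∧
        ∀ S : Schema, Inst.IsOver S (I : Inst ℕ) →
          (∃ O : Ontology, IsFiniteBasis L S I O) ∧
          (∀ O : Ontology, IsFiniteBasis L S I O →
            2 ^ 2 ^ n ≤ ontologySize O ∧ 2 ^ n ≤ succinctSize O)) := by
  refine ⟨⟨sizeBound (3 + (2 * (Polynomial.X + 1)) ^ 2) + 1 + sizeBound 4, fun n _ =>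
    ⟨cyclesStar (2 * (n + 1)), ?_, ⟨_, fitsTGD_treeTGD L _⟩,
      ⟨_, (fitsTGD_treeTGD L _).fitsOntology_singleton⟩, fun ρ hρ => ?_,
      fun O hO => fitsOntology_lower_bound hO⟩⟩,
    ⟨sizeBound (3 + (2 * (Polynomial.X + 1)) ^ 2), fun n _ => ⟨cycles (2 * (n + 1)),
      instSize_cycles_le n, fun S hS =>
        ⟨exists_isFiniteBasis L S _, fun O hO => isFiniteBasis_lower_bound hS hO⟩⟩⟩⟩
  · have h1 := instSize_cycles_le n
    have h2 := instSize_star_le n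
    simp only [FittingInstance.size, cyclesStar, Finset.sum_singleton, List.length_singleton,
      Polynomial.eval_add, Polynomial.eval_one]
    omega
  · simpa [ontologySize] using fitsOntology_lower_bound hρ.fitsOntology_singleton
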